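/- Let $F$ be a finite field, let $m\ge 4$, and let $F\langle X\rangle$ be the free associative unital $F$-algebra on $X=\{x_1,\dots,x_m\}$. There exists a recursively enumerable set $R\subset F\langle X\rangle$ of homogeneous elements such that the (graded, finitely generated, recursively presented) associative unital algebra $A=F\langle X\rangle/(R)$, where $(R)$ is the two-sided ideal generated by $R$, has the following properties: 1. $A$ is infinite; 2. $A$ is residually finite, i.e. for every nonzero $a\in A$ there is a two-sided ideal $I$ of $A$ with $a\notin I$ and $A/I$ finite; 3. $A$ is generated as a unital $F$-algebra by the images of $x_1,\dots,x_m$, and each of these images is nilpotent; 4. all finite Cartesian powers of $A$ are algorithmically finite: for every positive integer $n$ there is no algorithm that writes out an infinite sequence of pairwise different elements of $A^n$. (An element of $A^n$ is written as an $n$-tuple of expressions, each a finite sum of finite products of elements of $F$ and of the generators $x_1,\dots,x_m$.) In particular, over any finite field there is an infinite, finitely generated, recursively presented, residually finite associative unital algebra, generated by finitely many nilpotent elements, all of whose finite Cartesian powers are algorithmically finite. -/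

import Mathlib

namespace AlgFin

/-- Expressions written in the alphabet `F ⊔ X ⊔ {+}` with `X = {x₀, …, x_{m-1}}`: a finite list of
words over `F ⊔ X`. A word stands for the product of its symbols, the list for the sum of its
words. These are the finite objects which an algorithm can write out. -/
abbrev Expr (F : Type*) (m : ℕ) : Type _ := List (List (F ⊕ Fin m))

/-- The element of an `F`-algebra `A` denoted by an expression when `xᵢ` denotes `a i`. -/
def Expr.eval {F A : Type*} [Field F] [Ring A] [Algebra F A] {m : ℕ} (a : Fin m → A)
    (e : Expr F m) : A :=
  (e.map fun w => (w.map (Sum.elim (algebraMap F A) a)).prod).sum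

/-- The coding of a finite type by numbers given by a listing of its elements. The notions of
computability below do not depend on the listing, since any two differ by a finite table. -/
@[reducible] noncomputable def finitePrimcodable (F : Type*) [Finite F] : Primcodable F :=
  Primcodable.ofEquiv (Fin (Nat.card F)) (Finite.equivFin F)

/-- A set of noncommutative polynomials is recursively enumerable if it is the set of values of a
recursively enumerable set of expressions. -/
def IsRecursivelyEnumerable {F : Type*} [Field F] [Finite F] {m : ℕ}
    (R : Set (FreeAlgebra F (Fin m))) : Prop :=
  letI := finitePrimcodable F
  ∃ p : Expr F m → Prop, REPred p ∧ R = Expr.eval (FreeAlgebra.ι F) '' {e | p e}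

/-- The noncommutative polynomials that are homogeneous of degree `d` (zero included). -/
def homogeneous (F : Type*) [Field F] (m d : ℕ) : Submodule F (FreeAlgebra F (Fin m)) :=
  Submodule.span F {u | ∃ l : List (Fin m), l.length = d ∧ u = (l.map (FreeAlgebra.ι F)).prod}

/-- The algebra `F⟨X⟩ / (R)`, where `(R)` is the two-sided ideal generated by `R`. -/
abbrev Presented {F : Type*} [Field F] {m : ℕ} (R : Set (FreeAlgebra F (Fin m))) : Type _ :=
  (TwoSidedIdeal.span R).ringCon.Quotient

/-- The image of `xᵢ` in `F⟨X⟩ / (R)`. -/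
def Presented.gen {F : Type*} [Field F] {m : ℕ} (R : Set (FreeAlgebra F (Fin m))) (i : Fin m) :
    Presented R :=
  (TwoSidedIdeal.span R).ringCon.mk' (FreeAlgebra.ι F i)

/-- A ring is residually finite if every nonzero element lies outside some two-sided ideal with
finite quotient. For unital algebras the two-sided ideals of the ring are those of the algebra. -/
def IsResiduallyFinite (A : Type*) [Ring A] : Prop :=
  ∀ a : A, a ≠ 0 → ∃ I : TwoSidedIdeal A, a ∉ I ∧ Finite I.ringCon.Quotient

/-- The Cartesian power `Aⁿ` is algorithmically finite, where `A` is an algebra over a finite field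
generated by `a₀, …, a_{m-1}`: no algorithm writes out an infinite sequence of `n`-tuples of
expressions denoting pairwise different elements of `Aⁿ`. -/
def IsAlgorithmicallyFinitePower (F : Type*) [Field F] [Finite F] {A : Type*} [Ring A]
    [Algebra F A] {m : ℕ} (a : Fin m → A) (n : ℕ) : Prop :=
  letI := finitePrimcodable F
  ¬ ∃ u : ℕ → (Fin n → Expr F m), Computable u ∧
    Function.Injective fun (j : ℕ) (s : Fin n) => (u j s).eval a

end AlgFin

/-! To make every power of `A` algorithmically finite, each computable sequence of tuples must
repeat a value in `A`. Search the output of the program with index `e`, a sequence of `n`-tuples,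
for two tuples whose entries have the same coefficients at all words of length below `e + 2 + n`. If
the program is total with tuples of fixed length, such a pair exists by pigeonhole, since `F` is
finite and there are finitely many short words. All homogeneous components of the `n` entrywise
differences are imposed as relations; the search being effective, they form a recursively enumerable
set (`exists_relations`).

Weigh a relation of degree `d` by `2⁻ᵈ`. Program `e` contributes at most `n · 2 · 2^-(e+2+n) ≤
2^-(e+1)`, hence the total is at most 1 (`tsum_weight_le`). With at least four generators, a
Golod–Shafarevich estimate then shows that the quotient is nonzero in every degree
(`idealPart_ne_homogeneous`), so `A` is infinite.

The other properties follow from the grading. Truncating above a given degree leaves a finite ring,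
whence residual finiteness. The powers of `xᵢ` form a computable sequence, so `xᵢʲ - xᵢᵏ` lies in
the ideal for some `j < k`; its component of degree `j` is `xᵢʲ`, which is therefore zero in `A`. -/

namespace AlgFin

/-! ### The grading of the free algebra by word length. -/

section Grading

variable {F : Type*} [Field F] {m : ℕ}

/-- The monomial spelled by a word. -/
def word (F : Type*) [Field F] {m : ℕ} (l : List (Fin m)) : FreeAlgebra F (Fin m) :=
  (l.map (FreeAlgebra.ι F)).prod

@[simp] lemma word_nil : word F ([] : List (Fin m)) = 1 := rfl

@[simp] lemma word_cons (i : Fin m) (l : List (Fin m)) :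
    word F (i :: l) = FreeAlgebra.ι F i * word F l := by
  simp [word]

lemma word_append (l l' : List (Fin m)) : word F (l ++ l') = word F l * word F l' := by
  simp [word]

lemma word_mem (l : List (Fin m)) : word F l ∈ homogeneous F m l.length :=
  Submodule.subset_span ⟨l, rfl, rfl⟩

lemma word_eq_basis (l : List (Fin m)) :
    word F l = FreeAlgebra.basisFreeMonoid F (Fin m) (FreeMonoid.ofList l) := by
  simp only [FreeAlgebra.basisFreeMonoid, Module.Basis.map_apply, Finsupp.coe_basisSingleOne]
  change _ = FreeAlgebra.equivMonoidAlgebraFreeMonoid.symm (MonoidAlgebra.of F _ _)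
  rw [AlgEquiv.eq_symm_apply]
  induction l with
  | nil => simp; rfl
  | cons i l ih =>
    rw [word_cons, map_mul, ih, FreeMonoid.ofList_cons, map_mul]
    congr 1
    simp [FreeAlgebra.equivMonoidAlgebraFreeMonoid]

lemma linearIndependent_word : LinearIndependent F (word F : List (Fin m) → _) := by
  have := (FreeAlgebra.basisFreeMonoid F (Fin m)).linearIndependent.comp
    (FreeMonoid.ofList (α := Fin m)) FreeMonoid.ofList.injective
  have h : (word F : List (Fin m) → _) =
      FreeAlgebra.basisFreeMonoid F (Fin m) ∘ FreeMonoid.ofList := funext word_eq_basis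
  rw [h]
  exact this

lemma span_range_word : Submodule.span F (Set.range (word F : List (Fin m) → _)) = ⊤ := by
  rw [← (FreeAlgebra.basisFreeMonoid F (Fin m)).span_eq]
  congr 1
  ext x
  constructor
  · rintro ⟨l, rfl⟩; exact ⟨_, (word_eq_basis l).symm⟩
  · rintro ⟨l, rfl⟩; exact ⟨FreeMonoid.toList l, word_eq_basis _⟩

lemma word_induction {p : FreeAlgebra F (Fin m) → Prop} (hw : ∀ l, p (word F l))
    (hadd : ∀ x y, p x → p y → p (x + y)) (hsmul : ∀ (c : F) x, p x → p (c • x)) (x) : p x := by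
  have hx : x ∈ Submodule.span F (Set.range (word F : List (Fin m) → _)) := by
    rw [span_range_word]; trivial
  induction hx using Submodule.span_induction with
  | mem x h => obtain ⟨l, rfl⟩ := h; exact hw l
  | zero => simpa using hsmul 0 _ (hw [])
  | add x y _ _ hx hy => exact hadd x y hx hy
  | smul c x _ hx => exact hsmul c x hx

lemma homogeneous_eq_span (d : ℕ) :
    homogeneous F m d = Submodule.span F (Set.range fun v : List.Vector (Fin m) d =>
      word F v.toList) := by
  unfold homogeneous
  congr 1
  ext u
  constructor
  · rintro ⟨l, hl, rfl⟩; exact ⟨⟨l, hl⟩, rfl⟩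
  · rintro ⟨v, rfl⟩; exact ⟨v.toList, v.toList_length, rfl⟩

instance (d : ℕ) : FiniteDimensional F (homogeneous F m d) := by
  rw [homogeneous_eq_span]
  exact FiniteDimensional.span_of_finite F (Set.finite_range _)

lemma finrank_homogeneous (d : ℕ) : Module.finrank F (homogeneous F m d) = m ^ d := by
  rw [homogeneous_eq_span, finrank_span_eq_card]
  · simp
  · exact linearIndependent_word.comp _ List.Vector.toList_injective

lemma homogeneous_mul_le (a b : ℕ) :
    homogeneous F m a * homogeneous F m b ≤ homogeneous F m (a + b) := by
  unfold homogeneous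
  rw [Submodule.span_mul_span]
  apply Submodule.span_mono
  rintro _ ⟨_, ⟨l, hl, rfl⟩, _, ⟨l', hl', rfl⟩, rfl⟩
  exact ⟨l ++ l', by simp [hl, hl'], by simp⟩

lemma mul_mem_homogeneous {a b : ℕ} {u v : FreeAlgebra F (Fin m)} (hu : u ∈ homogeneous F m a)
    (hv : v ∈ homogeneous F m b) : u * v ∈ homogeneous F m (a + b) :=
  homogeneous_mul_le a b (Submodule.mul_mem_mul hu hv)

lemma homogeneous_succ_le (d : ℕ) :
    homogeneous F m (d + 1) ≤ homogeneous F m d * homogeneous F m 1 := by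
  rw [homogeneous, Submodule.span_le]
  rintro _ ⟨l, hl, rfl⟩
  obtain rfl | ⟨l', i, rfl⟩ := l.eq_nil_or_concat
  · simp at hl
  change word F _ ∈ _
  rw [List.concat_eq_append, word_append]
  refine Submodule.mul_mem_mul ?_ (word_mem [i])
  have := word_mem (F := F) l'
  simp at hl
  rwa [hl] at this

/-- The homomorphism multiplying every monomial by the power of a central variable recording its
degree. -/
noncomputable def gradingHom (F : Type*) [Field F] (m : ℕ) :
    FreeAlgebra F (Fin m) →ₐ[F] Polynomial (FreeAlgebra F (Fin m)) :=
  FreeAlgebra.lift F fun i => Polynomial.monomial 1 (FreeAlgebra.ι F i)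

lemma gradingHom_word (l : List (Fin m)) :
    gradingHom F m (word F l) = Polynomial.monomial l.length (word F l) := by
  induction l with
  | nil => simp
  | cons i l ih =>
    rw [word_cons, map_mul, ih, gradingHom, FreeAlgebra.lift_ι_apply,
      Polynomial.monomial_mul_monomial, List.length_cons, add_comm]

/-- The homogeneous component of degree `d`. -/
noncomputable def component (d : ℕ) : FreeAlgebra F (Fin m) →ₗ[F] FreeAlgebra F (Fin m) where
  toFun u := (gradingHom F m u).coeff d
  map_add' := by simp
  map_smul' := by simp

lemma component_word (d : ℕ) (l : List (Fin m)) :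
    component d (word F l) = if l.length = d then word F l else 0 := by
  simp [component, gradingHom_word, Polynomial.coeff_monomial]

lemma component_mul (d : ℕ) (u v : FreeAlgebra F (Fin m)) :
    component d (u * v) = ∑ p ∈ Finset.HasAntidiagonal.antidiagonal d, component p.1 u * component p.2 v := by
  simp [component, Polynomial.coeff_mul]

lemma component_mem (d : ℕ) (u : FreeAlgebra F (Fin m)) : component d u ∈ homogeneous F m d := by
  induction u using word_induction with
  | hw l =>
    rw [component_word]
    split_ifs with h
    · exact h ▸ word_mem l
    · exact zero_mem _
  | hadd x y hx hy => rw [map_add]; exact add_mem hx hy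
  | hsmul c x hx => rw [map_smul]; exact Submodule.smul_mem _ c hx

lemma component_of_mem {e : ℕ} {u : FreeAlgebra F (Fin m)} (hu : u ∈ homogeneous F m e) (d : ℕ) :
    component d u = if d = e then u else 0 := by
  induction hu using Submodule.span_induction with
  | mem x h =>
    obtain ⟨l, rfl, rfl⟩ := h
    exact (component_word d l).trans (by simp only [eq_comm]; rfl)
  | zero => simp
  | add x y _ _ hx hy => rw [map_add, hx, hy]; split_ifs <;> simp
  | smul c x _ hx => rw [map_smul, hx]; split_ifs <;> simp

lemma sum_component (u : FreeAlgebra F (Fin m)) :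
    ∑ d ∈ (gradingHom F m u).support, component d u = u := by
  -- Setting the degree-recording variable to 1 recovers the element.
  have h : (gradingHom F m u).eval 1 = u := by
    induction u using word_induction with
    | hw l => simp [gradingHom_word]
    | hadd x y hx hy => rw [map_add, Polynomial.eval_add, hx, hy]
    | hsmul c x hx => rw [map_smul, Polynomial.eval_smul, hx]
  conv_rhs => rw [← h, Polynomial.eval_eq_sum]
  simp [Polynomial.sum, component]

end Grading

/-! ### The Golod–Shafarevich estimate and quotients by homogeneous ideals. -/

section GolodShafarevich

open Module

variable {F : Type*} [Field F] {m : ℕ} {ι : Type*}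

/-- The degree `d` part of the two-sided ideal generated by homogeneous elements `f i` of degrees
`deg i`. -/
def idealPart (f : ι → FreeAlgebra F (Fin m)) (deg : ι → ℕ) (d : ℕ) :
    Submodule F (FreeAlgebra F (Fin m)) :=
  Submodule.span F {t | ∃ (i : ι) (a b : ℕ) (u v : FreeAlgebra F (Fin m)), a + deg i + b = d ∧
    u ∈ homogeneous F m a ∧ v ∈ homogeneous F m b ∧ t = u * f i * v}

variable {f : ι → FreeAlgebra F (Fin m)} {deg : ι → ℕ}

lemma mul_mem_idealPart_left {a d : ℕ} {u t : FreeAlgebra F (Fin m)} (hu : u ∈ homogeneous F m a)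
    (ht : t ∈ idealPart f deg d) : u * t ∈ idealPart f deg (a + d) := by
  induction ht using Submodule.span_induction with
  | mem x h =>
    obtain ⟨i, a', b, u', v, rfl, hu', hv, rfl⟩ := h
    exact Submodule.subset_span ⟨i, a + a', b, u * u', v, by ring, mul_mem_homogeneous hu hu', hv,
      by simp only [mul_assoc]⟩
  | zero => simp
  | add x y _ _ hx hy => rw [mul_add]; exact add_mem hx hy
  | smul c x _ hx => rw [mul_smul_comm]; exact Submodule.smul_mem _ c hx

lemma mul_mem_idealPart_right {b d : ℕ} {v t : FreeAlgebra F (Fin m)}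
    (hv : v ∈ homogeneous F m b) (ht : t ∈ idealPart f deg d) :
    t * v ∈ idealPart f deg (d + b) := by
  induction ht using Submodule.span_induction with
  | mem x h =>
    obtain ⟨i, a, b', u, v', rfl, hu, hv', rfl⟩ := h
    exact Submodule.subset_span ⟨i, a, b' + b, u, v' * v, by ring, hu, mul_mem_homogeneous hv' hv,
      by simp only [mul_assoc]⟩
  | zero => simp
  | add x y _ _ hx hy => rw [add_mul]; exact add_mem hx hy
  | smul c x _ hx => rw [smul_mul_assoc]; exact Submodule.smul_mem _ c hx

lemma one_mem_homogeneous : (1 : FreeAlgebra F (Fin m)) ∈ homogeneous F m 0 := word_mem []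

lemma generator_mem_idealPart (i : ι) : f i ∈ idealPart f deg (deg i) :=
  Submodule.subset_span ⟨i, 0, 0, 1, 1, by simp, one_mem_homogeneous, one_mem_homogeneous, by simp⟩

lemma idealPart_le (hf : ∀ i, f i ∈ homogeneous F m (deg i)) (d : ℕ) :
    idealPart f deg d ≤ homogeneous F m d := by
  rw [idealPart, Submodule.span_le]
  rintro _ ⟨i, a, b, u, v, rfl, hu, hv, rfl⟩
  exact mul_mem_homogeneous (mul_mem_homogeneous hu (hf i)) hv

/-- The elements whose components all lie in the graded pieces form a two-sided ideal containing the
generators. Thus an ideal generated by homogeneous elements is graded. -/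
lemma component_mem_idealPart (hf : ∀ i, f i ∈ homogeneous F m (deg i))
    {x : FreeAlgebra F (Fin m)} (hx : x ∈ TwoSidedIdeal.span (Set.range f)) (d : ℕ) :
    component d x ∈ idealPart f deg d := by
  let I : TwoSidedIdeal (FreeAlgebra F (Fin m)) :=
    TwoSidedIdeal.mk' {x | ∀ d, component d x ∈ idealPart f deg d} (fun d => by simp)
      (fun hx hy d => by rw [map_add]; exact add_mem (hx d) (hy d))
      (fun hx d => by rw [map_neg]; exact neg_mem (hx d))
      (fun {x y} hy d => by
        rw [component_mul]
        refine Submodule.sum_mem _ fun p hp => ?_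
        rw [← Finset.HasAntidiagonal.mem_antidiagonal.1 hp]
        exact mul_mem_idealPart_left (component_mem _ _) (hy _))
      (fun {x y} hx d => by
        rw [component_mul]
        refine Submodule.sum_mem _ fun p hp => ?_
        rw [← Finset.HasAntidiagonal.mem_antidiagonal.1 hp]
        exact mul_mem_idealPart_right (component_mem _ _) (hx _))
  have hI : TwoSidedIdeal.span (Set.range f) ≤ I := by
    rw [TwoSidedIdeal.span_le]
    rintro _ ⟨i, rfl⟩
    rw [SetLike.mem_coe, TwoSidedIdeal.mem_mk']
    intro d
    rw [component_of_mem (hf i)]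
    split_ifs with h
    · exact h ▸ generator_mem_idealPart i
    · exact zero_mem _
  have := hI hx
  rw [TwoSidedIdeal.mem_mk'] at this
  exact this d

lemma smul_mem_twoSidedIdeal (I : TwoSidedIdeal (FreeAlgebra F (Fin m))) (c : F)
    {x : FreeAlgebra F (Fin m)} (hx : x ∈ I) : c • x ∈ I := by
  rw [Algebra.smul_def]; exact I.mul_mem_left _ _ hx

lemma mem_span_of_mem_idealPart {d : ℕ} {x : FreeAlgebra F (Fin m)}
    (hx : x ∈ idealPart f deg d) : x ∈ TwoSidedIdeal.span (Set.range f) := by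
  induction hx using Submodule.span_induction with
  | mem x h =>
    obtain ⟨i, a, b, u, v, rfl, hu, hv, rfl⟩ := h
    exact TwoSidedIdeal.mul_mem_right _ _ _ (TwoSidedIdeal.mul_mem_left _ _ _
      (TwoSidedIdeal.subset_span ⟨i, rfl⟩))
  | zero => exact zero_mem _
  | add x y _ _ hx hy => exact add_mem hx hy
  | smul c x _ hx => exact smul_mem_twoSidedIdeal _ c hx

lemma component_mem_span (hf : ∀ i, f i ∈ homogeneous F m (deg i))
    {x : FreeAlgebra F (Fin m)} (hx : x ∈ TwoSidedIdeal.span (Set.range f)) (d : ℕ) :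
    component d x ∈ TwoSidedIdeal.span (Set.range f) :=
  mem_span_of_mem_idealPart (component_mem_idealPart hf hx d)

lemma mem_of_component_mem {I : TwoSidedIdeal (FreeAlgebra F (Fin m))} {x : FreeAlgebra F (Fin m)}
    (h : ∀ d, component d x ∈ I) : x ∈ I := by
  rw [← sum_component x]
  exact sum_mem fun d _ => h d

lemma finrank_mul_span_le (P : Submodule F (FreeAlgebra F (Fin m))) [FiniteDimensional F P]
    (x : FreeAlgebra F (Fin m)) :
    FiniteDimensional F (P * Submodule.span F {x} : Submodule F (FreeAlgebra F (Fin m))) ∧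
    finrank F (P * Submodule.span F {x} : Submodule F (FreeAlgebra F (Fin m))) ≤ finrank F P := by
  have h : P * Submodule.span F {x} = P.map (LinearMap.mulRight F x) := by
    apply le_antisymm
    · rw [Submodule.mul_le]
      intro p hp q hq
      obtain ⟨c, rfl⟩ := Submodule.mem_span_singleton.1 hq
      exact ⟨c • p, Submodule.smul_mem _ c hp, by simp⟩
    · rintro _ ⟨p, hp, rfl⟩
      exact Submodule.mul_mem_mul hp (Submodule.mem_span_singleton_self x)
  rw [h]
  exact ⟨inferInstance, Submodule.finrank_map_le _ _⟩

lemma finrank_finsetSup_le {V κ : Type*} [AddCommGroup V] [Module F V] (s : Finset κ)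
    (P : κ → Submodule F V) (hP : ∀ i, FiniteDimensional F (P i)) :
    finrank F (s.sup P : Submodule F V) ≤ ∑ i ∈ s, finrank F (P i) := by
  classical
  induction s using Finset.induction_on with
  | empty => simp
  | insert i s hi ih =>
    rw [Finset.sup_insert, Finset.sum_insert hi]
    have : FiniteDimensional F (s.sup P : Submodule F V) :=
      Submodule.finiteDimensional_finset_sup _ _
    exact (Submodule.finrank_add_le_finrank_add_finrank _ _).trans (by gcongr)

lemma exists_complement_idealPart (hf : ∀ i, f i ∈ homogeneous F m (deg i)) (d : ℕ) :
    ∃ C : Submodule F (FreeAlgebra F (Fin m)), FiniteDimensional F C ∧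
      idealPart f deg d ⊔ C = homogeneous F m d ∧
      finrank F (idealPart f deg d) + finrank F C = m ^ d := by
  obtain ⟨C, hC⟩ := (idealPart f deg d).exists_isCompl
  have hle := idealPart_le hf d
  have hsup : idealPart f deg d ⊔ C ⊓ homogeneous F m d = homogeneous F m d := by
    rw [← sup_inf_assoc_of_le _ hle, hC.sup_eq_top, top_inf_eq]
  have h1 : FiniteDimensional F (idealPart f deg d) := Submodule.finiteDimensional_of_le hle
  have h2 : FiniteDimensional F (C ⊓ homogeneous F m d : Submodule F (FreeAlgebra F (Fin m))) :=
    Submodule.finiteDimensional_of_le inf_le_right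
  refine ⟨C ⊓ homogeneous F m d, h2, hsup, ?_⟩
  rw [← Submodule.finrank_sup_add_finrank_inf_eq, hsup, ← inf_assoc, hC.inf_eq_bot, bot_inf_eq,
    finrank_bot, finrank_homogeneous, add_zero]

/-- The recursive dimension bound behind the Golod–Shafarevich theorem. -/
lemma finrank_idealPart_succ_le (hf : ∀ i, f i ∈ homogeneous F m (deg i)) (hdeg : ∀ i, 0 < deg i)
    (d : ℕ) (S : Finset ι) (hS : ∀ i, deg i ≤ d + 1 ↔ i ∈ S) :
    finrank F (idealPart f deg (d + 1)) ≤ m * finrank F (idealPart f deg d) +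
      ∑ i ∈ S, (m ^ (d + 1 - deg i) - finrank F (idealPart f deg (d + 1 - deg i))) := by
  choose C hCfin hC hCrank using exists_complement_idealPart (f := f) (deg := deg) hf
  have hJ : FiniteDimensional F (idealPart f deg d) :=
    Submodule.finiteDimensional_of_le (idealPart_le hf d)
  set P : Fin m → Submodule F (FreeAlgebra F (Fin m)) := fun i =>
    idealPart f deg d * Submodule.span F {FreeAlgebra.ι F i}
  set Q : ι → Submodule F (FreeAlgebra F (Fin m)) := fun i =>
    C (d + 1 - deg i) * Submodule.span F {f i}
  have hP : ∀ i, FiniteDimensional F (P i) := fun i => (finrank_mul_span_le _ _).1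
  have hQ : ∀ i, FiniteDimensional F (Q i) := fun i => (finrank_mul_span_le _ _).1
  have hV1 : idealPart f deg d * homogeneous F m 1 ≤ Finset.univ.sup P := by
    rw [Submodule.mul_le]
    intro p hp q hq
    induction hq using Submodule.span_induction with
    | mem x h =>
      obtain ⟨l, hl, rfl⟩ := h
      obtain ⟨i, rfl⟩ := List.length_eq_one_iff.1 hl
      refine (Finset.le_sup (f := P) (Finset.mem_univ i)) ?_
      simpa using Submodule.mul_mem_mul hp (Submodule.mem_span_singleton_self (FreeAlgebra.ι F i))
    | zero => simp
    | add x y _ _ hx hy => rw [mul_add]; exact add_mem hx hy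
    | smul c x _ hx => rw [mul_smul_comm]; exact Submodule.smul_mem _ c hx
  -- With `I_d` the degree `d` part of the ideal, `I_{d+1}` is covered by `I_d · X` and the `C · f
  -- i`, where `C` complements the ideal in degree `d + 1 - deg i`. If the right factor `v` has
  -- positive degree, its last letter splits off, giving an element of `I_d · X`.
  have key : idealPart f deg (d + 1) ≤ Finset.univ.sup P ⊔ S.sup Q := by
    rw [idealPart, Submodule.span_le]
    rintro _ ⟨i, a, b, u, v, hd, hu, hv, rfl⟩
    rw [SetLike.mem_coe]
    cases b with
    | succ b =>
      refine Submodule.mem_sup_left (hV1 ?_)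
      have hv' := homogeneous_succ_le b hv
      have hsub : Submodule.span F {u * f i} * homogeneous F m b ≤ idealPart f deg d := by
        rw [Submodule.mul_le]
        intro p hp q hq
        obtain ⟨c, rfl⟩ := Submodule.mem_span_singleton.1 hp
        rw [smul_mul_assoc]
        exact Submodule.smul_mem _ c (Submodule.subset_span ⟨i, a, b, u, q, by omega, hu, hq, rfl⟩)
      have := Submodule.mul_mem_mul (Submodule.mem_span_singleton_self (R := F) (u * f i)) hv'
      rw [← mul_assoc] at this
      exact mul_le_mul' hsub le_rfl this
    | zero =>
      have ha : a = d + 1 - deg i := by omega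
      obtain ⟨c, rfl⟩ : ∃ c : F, v = c • 1 := by
        induction hv using Submodule.span_induction with
        | mem x h =>
          obtain ⟨l, hl, rfl⟩ := h
          obtain rfl := List.length_eq_zero_iff.1 hl
          exact ⟨1, by simp⟩
        | zero => exact ⟨0, by simp⟩
        | add x y _ _ hx hy =>
          obtain ⟨c, rfl⟩ := hx
          obtain ⟨c', rfl⟩ := hy
          exact ⟨c + c', (add_smul _ _ _).symm⟩
        | smul c x _ hx => obtain ⟨c', rfl⟩ := hx; exact ⟨c * c', smul_smul _ _ _⟩
      rw [mul_smul_comm, mul_one]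
      refine Submodule.smul_mem _ c ?_
      -- Here `v` is a scalar. Split `u = y + z` with `y` in the ideal and `z` in `C`. The last
      -- letter of `f i`, which has positive degree, can be split off to put `y * f i` in `I_d · X`;
      -- only `z * f i` needs `Q`.
      rw [ha, ← hC, Submodule.mem_sup] at hu
      obtain ⟨y, hy, z, hz, rfl⟩ := hu
      rw [add_mul]
      refine add_mem (Submodule.mem_sup_left (hV1 ?_)) (Submodule.mem_sup_right ?_)
      · obtain ⟨k, hk⟩ : ∃ k, deg i = k + 1 := ⟨deg i - 1, by have := hdeg i; omega⟩
        have hfi := hf i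
        rw [hk] at hfi
        have hsub : Submodule.span F {y} * homogeneous F m k ≤ idealPart f deg d := by
          rw [Submodule.mul_le]
          intro p hp q hq
          obtain ⟨c, rfl⟩ := Submodule.mem_span_singleton.1 hp
          rw [smul_mul_assoc]
          refine Submodule.smul_mem _ c ?_
          have := mul_mem_idealPart_right hq hy
          rwa [show d + 1 - deg i + k = d by omega] at this
        have := Submodule.mul_mem_mul (Submodule.mem_span_singleton_self (R := F) y)
          (homogeneous_succ_le k hfi)
        rw [← mul_assoc] at this
        exact mul_le_mul' hsub le_rfl this
      · refine (Finset.le_sup (f := Q) ((hS i).1 (by omega))) ?_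
        exact Submodule.mul_mem_mul hz (Submodule.mem_span_singleton_self _)
  have hPs : FiniteDimensional F (Finset.univ.sup P : Submodule F (FreeAlgebra F (Fin m))) :=
    Submodule.finiteDimensional_finset_sup _ _
  have hQs : FiniteDimensional F (S.sup Q : Submodule F (FreeAlgebra F (Fin m))) :=
    Submodule.finiteDimensional_finset_sup _ _
  calc _ ≤ finrank F (Finset.univ.sup P ⊔ S.sup Q : Submodule F (FreeAlgebra F (Fin m))) :=
        Submodule.finrank_mono key
    _ ≤ _ := Submodule.finrank_add_le_finrank_add_finrank _ _
    _ ≤ ∑ i, finrank F (P i) + ∑ i ∈ S, finrank F (Q i) :=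
        add_le_add (finrank_finsetSup_le _ _ hP) (finrank_finsetSup_le _ _ hQ)
    _ ≤ ∑ i : Fin m, finrank F (idealPart f deg d) +
        ∑ i ∈ S, finrank F (C (d + 1 - deg i)) := by
        gcongr
        · exact (finrank_mul_span_le _ _).2
        · exact (finrank_mul_span_le _ _).2
    _ ≤ _ := by
        rw [Finset.sum_const, Finset.card_univ, Fintype.card_fin, smul_eq_mul]
        gcongr with i hi
        have := hCrank (d + 1 - deg i)
        omega

/-- A Golod–Shafarevich theorem: few homogeneous relations leave room in every degree. -/
theorem idealPart_ne_homogeneous (hm : 4 ≤ m) (hf : ∀ i, f i ∈ homogeneous F m (deg i))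
    (hdeg : ∀ i, 0 < deg i) (hw : ∑' i, (2 : ENNReal)⁻¹ ^ deg i ≤ 1) (d : ℕ) :
    idealPart f deg d ≠ homogeneous F m d := by
  -- Each relation of degree at most `d` weighs at least `2⁻ᵈ`, so a finite total weight allows only
  -- finitely many.
  have hfin : ∀ d, {i | deg i ≤ d}.Finite := fun d => by
    refine (ENNReal.finite_const_le_of_tsum_ne_top (ne_top_of_le_ne_top ENNReal.one_ne_top hw)
      (ε := 2⁻¹ ^ d) (by simp)).subset fun i hi => ?_
    have h2 : (2 : ENNReal)⁻¹ ≤ 1 := by simp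
    exact pow_le_pow_right_of_le_one' h2 hi
  have hsum : ∀ S : Finset ι, ∑ i ∈ S, (2 : ℝ)⁻¹ ^ deg i ≤ 1 := fun S => by
    have h := (ENNReal.sum_le_tsum S).trans hw
    have h' := ENNReal.toReal_mono ENNReal.one_ne_top h
    rw [ENNReal.toReal_sum (fun i _ => ENNReal.pow_ne_top (by simp))] at h'
    simpa [ENNReal.toReal_inv] using h'
  set r : ℕ → ℕ := fun k => m ^ k - finrank F (idealPart f deg k) with hr
  have hrk : ∀ k, r k + finrank F (idealPart f deg k) = m ^ k := fun k => by
    obtain ⟨C, -, -, hC⟩ := exists_complement_idealPart hf k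
    simp only [hr]; omega
  -- Here `r k` is the dimension of the quotient in degree `k`. Growth by doubling up to `k` bounds
  -- the loss from a relation of degree `e + 1` by `r k / 2 ^ e`, twice its weight times `r k`. The
  -- losses total at most `2 * r k`, and `m * r k ≥ 4 * r k`, so doubling persists.
  have hstep : ∀ k, (∀ j ≤ k, 2 ^ j * r (k - j) ≤ r k) → 2 * r k ≤ r (k + 1) := by
    intro k hk
    have h := finrank_idealPart_succ_le hf hdeg k (hfin (k + 1)).toFinset (fun i => by simp)
    change _ ≤ _ + ∑ i ∈ _, r (k + 1 - deg i) at h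
    have hS : ((∑ i ∈ (hfin (k + 1)).toFinset, r (k + 1 - deg i) : ℕ) : ℝ) ≤ 2 * r k := by
      push_cast
      calc _ ≤ ∑ i ∈ (hfin (k + 1)).toFinset, 2 * (r k : ℝ) * 2⁻¹ ^ deg i := by
            refine Finset.sum_le_sum fun i hi => ?_
            simp only [Set.Finite.mem_toFinset, Set.mem_ofPred_eq] at hi
            obtain ⟨e, he⟩ : ∃ e, deg i = e + 1 := ⟨deg i - 1, by have := hdeg i; omega⟩
            have := hk e (by omega)
            rw [he, show k + 1 - (e + 1) = k - e by omega, pow_succ,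
              show 2 * (r k : ℝ) * (2⁻¹ ^ e * 2⁻¹) = r k / 2 ^ e by rw [inv_pow]; ring,
              le_div_iff₀ (by positivity), mul_comm]
            exact_mod_cast this
        _ = 2 * r k * ∑ i ∈ (hfin (k + 1)).toFinset, (2 : ℝ)⁻¹ ^ deg i := by
            rw [Finset.mul_sum]
        _ ≤ 2 * r k * 1 := by gcongr; exact hsum _
        _ = 2 * r k := mul_one _
    have hS' : ∑ i ∈ (hfin (k + 1)).toFinset, r (k + 1 - deg i) ≤ 2 * r k := by exact_mod_cast hS
    have h1 := hrk (k + 1)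
    have h2 : m * r k + m * finrank F (idealPart f deg k) = m ^ (k + 1) := by
      rw [← mul_add, hrk, pow_succ, mul_comm]
    have h3 : 4 * r k ≤ m * r k := Nat.mul_le_mul_right _ hm
    omega
  have hgrow : ∀ k, ∀ j ≤ k, 2 ^ j * r (k - j) ≤ r k := by
    intro k
    induction k with
    | zero => intro j hj; obtain rfl : j = 0 := by omega
              simp
    | succ k ih =>
      intro j hj
      cases j with
      | zero => simp
      | succ j =>
        have := ih j (by omega)
        have := hstep k ih
        rw [show k + 1 - (j + 1) = k - j by omega, pow_succ]
        linarith
  have h0 : r 0 = 1 := by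
    have : idealPart f deg 0 = ⊥ := by
      rw [idealPart, Submodule.span_eq_bot]
      rintro _ ⟨i, a, b, u, v, h, -⟩
      have := hdeg i
      omega
    change m ^ 0 - finrank F (idealPart f deg 0) = 1
    rw [this, finrank_bot, pow_zero, Nat.sub_zero]
  intro h
  have h1 := hgrow d d le_rfl
  have h2 := hrk d
  rw [h, finrank_homogeneous] at h2
  rw [Nat.sub_self, h0] at h1
  have : 0 < 2 ^ d := by positivity
  omega

/-- Homogeneous elements outside a graded ideal, one in each degree, are pairwise incongruent. -/
theorem infinite_presented (hm : 4 ≤ m) (hf : ∀ i, f i ∈ homogeneous F m (deg i))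
    (hdeg : ∀ i, 0 < deg i) (hw : ∑' i, (2 : ENNReal)⁻¹ ^ deg i ≤ 1) :
    Infinite (Presented (Set.range f)) := by
  have h : ∀ d, ∃ w ∈ homogeneous F m d, w ∉ TwoSidedIdeal.span (Set.range f) := fun d => by
    obtain ⟨w, hw, hw'⟩ := SetLike.exists_of_lt
      (lt_of_le_of_ne (idealPart_le hf d) (idealPart_ne_homogeneous hm hf hdeg hw d))
    refine ⟨w, hw, fun hI => hw' ?_⟩
    simpa [component_of_mem hw] using component_mem_idealPart hf hI d
  choose w hw hw' using h
  refine Infinite.of_injective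
    (fun d => (TwoSidedIdeal.span (Set.range f)).ringCon.mk' (w d)) fun d e hde => ?_
  by_contra hne
  have h1 : w d - w e ∈ TwoSidedIdeal.span (Set.range f) := by
    rw [← TwoSidedIdeal.rel_iff]; exact (RingCon.eq _).1 hde
  have h2 := component_mem_span hf h1 d
  rw [map_sub, component_of_mem (hw d), component_of_mem (hw e), if_pos rfl, if_neg hne,
    sub_zero] at h2
  exact hw' d h2

theorem isResiduallyFinite_presented [Finite F] (hf : ∀ i, f i ∈ homogeneous F m (deg i)) :
    IsResiduallyFinite (Presented (Set.range f)) := by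
  intro a ha
  obtain ⟨t, rfl⟩ := RingCon.mk'_surjective (TwoSidedIdeal.span (Set.range f)).ringCon a
  set I := TwoSidedIdeal.span (Set.range f) with hI
  have ht : t ∉ I := fun h => ha ((RingCon.eq _).2 h)
  obtain ⟨D, hD⟩ : ∃ D, component D t ∉ I := by
    by_contra! h; exact ht (mem_of_component_mem h)
  -- `J` is the ideal enlarged by everything of degree above `D`. It still omits `t`, and its
  -- quotient is finite because components of degree at most `D` determine a class.
  let J : TwoSidedIdeal (FreeAlgebra F (Fin m)) :=
    TwoSidedIdeal.mk' {x | ∀ d ≤ D, component d x ∈ I} (fun d _ => by simp [zero_mem])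
      (fun hx hy d hd => by rw [map_add]; exact add_mem (hx d hd) (hy d hd))
      (fun hx d hd => by rw [map_neg]; exact neg_mem (hx d hd))
      (fun {x y} hy d hd => by
        rw [component_mul]
        refine sum_mem fun p hp => I.mul_mem_left _ _ (hy _ ?_)
        have := Finset.HasAntidiagonal.mem_antidiagonal.1 hp
        omega)
      (fun {x y} hx d hd => by
        rw [component_mul]
        refine sum_mem fun p hp => I.mul_mem_right _ _ (hx _ ?_)
        have := Finset.HasAntidiagonal.mem_antidiagonal.1 hp
        omega)
  have hJ : ∀ x, x ∈ J ↔ ∀ d ≤ D, component d x ∈ I := fun x => TwoSidedIdeal.mem_mk' ..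
  have hIJ : I.ringCon ≤ J.ringCon := by
    rw [← TwoSidedIdeal.ringCon_le_iff]
    intro x hx
    exact (hJ x).2 fun d _ => component_mem_span hf hx d
  let φ : Presented (Set.range f) →+* J.ringCon.Quotient := RingCon.map _ _ hIJ
  have hfin : Finite J.ringCon.Quotient := by
    have hV : ∀ d : Fin (D + 1), Finite (homogeneous F m d) := fun d => Module.finite_of_finite F
    refine Finite.of_surjective (fun v : (∀ d : Fin (D + 1), homogeneous F m d) =>
      J.ringCon.mk' (∑ d, (v d : FreeAlgebra F (Fin m)))) fun q => ?_
    obtain ⟨x, rfl⟩ := RingCon.mk'_surjective J.ringCon q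
    refine ⟨fun d => ⟨component d x, component_mem _ _⟩, (RingCon.eq _).2 ?_⟩
    rw [TwoSidedIdeal.rel_iff, hJ]
    intro e he
    have : component e (∑ d : Fin (D + 1), component d x) = component e x := by
      rw [map_sum, Finset.sum_eq_single (⟨e, by omega⟩ : Fin (D + 1))]
      · simp [component_of_mem (component_mem e x)]
      · intro b _ hb
        rw [component_of_mem (component_mem b x), if_neg]
        rintro rfl; exact hb rfl
      · simp
    rw [map_sub, this, sub_self]
    exact zero_mem _
  refine ⟨TwoSidedIdeal.ker φ, fun h => hD ?_, ?_⟩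
  · rw [TwoSidedIdeal.mem_ker] at h
    exact (hJ t).1 ((RingCon.eq _).1 h) D le_rfl
  · exact Finite.of_injective _ (RingCon.kerLift_injective φ)

/-- The quotient map from the free algebra as a homomorphism of algebras. -/
noncomputable def Presented.mk (R : Set (FreeAlgebra F (Fin m))) : FreeAlgebra F (Fin m) →ₐ[F] Presented R :=
  (TwoSidedIdeal.span R).ringCon.mkₐ F

lemma Presented.mk_eq_mk_iff {R : Set (FreeAlgebra F (Fin m))} {x y : FreeAlgebra F (Fin m)} :
    Presented.mk R x = Presented.mk R y ↔ x - y ∈ TwoSidedIdeal.span R := by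
  rw [← TwoSidedIdeal.rel_iff]; exact RingCon.eq _

theorem adjoin_gen_presented (R : Set (FreeAlgebra F (Fin m))) :
    Algebra.adjoin F (Set.range (Presented.gen R)) = ⊤ := by
  have h : Set.range (Presented.gen R) = Presented.mk R '' Set.range (FreeAlgebra.ι F) := by
    rw [← Set.range_comp]; rfl
  rw [h, ← AlgHom.map_adjoin, FreeAlgebra.adjoin_range_ι, Algebra.map_top, AlgHom.range_eq_top]
  exact RingCon.mk'_surjective _

lemma eval_gen (R : Set (FreeAlgebra F (Fin m))) (e : Expr F m) :
    e.eval (Presented.gen R) = Presented.mk R (e.eval (FreeAlgebra.ι F)) := by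
  rw [Expr.eval, Expr.eval, map_list_sum, List.map_map]
  congr 2
  ext w
  rw [Function.comp_apply, map_list_prod, List.map_map]
  congr 2
  ext s
  cases s
  · simp
  · rfl

end GolodShafarevich

/-! ### Primitive recursive arithmetic on expressions. -/

section Expressions

variable {F : Type*} [Field F] {m : ℕ}

/-- The product of the scalars in a word over `F ⊔ X`. -/
def scalarPart (t : List (F ⊕ Fin m)) : F := (t.filterMap Sum.getLeft?).prod

/-- The word over `X` obtained by deleting the scalars of a word over `F ⊔ X`. -/
def letterPart (t : List (F ⊕ Fin m)) : List (Fin m) := t.filterMap Sum.getRight?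

@[simp] lemma scalarPart_inl (c : F) (t : List (F ⊕ Fin m)) :
    scalarPart (Sum.inl c :: t) = c * scalarPart t := by
  simp [scalarPart]

@[simp] lemma scalarPart_inr (i : Fin m) (t : List (F ⊕ Fin m)) :
    scalarPart (Sum.inr i :: t) = scalarPart t := rfl

@[simp] lemma letterPart_inl {F : Type*} (c : F) (t : List (F ⊕ Fin m)) :
    letterPart (Sum.inl c :: t) = letterPart t := rfl

@[simp] lemma letterPart_inr {F : Type*} (i : Fin m) (t : List (F ⊕ Fin m)) :
    letterPart (Sum.inr i :: t) = i :: letterPart t := rfl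

lemma prod_map_eq_smul_word (t : List (F ⊕ Fin m)) :
    (t.map (Sum.elim (algebraMap F (FreeAlgebra F (Fin m))) (FreeAlgebra.ι F))).prod =
      scalarPart t • word F (letterPart t) := by
  induction t with
  | nil => simp [scalarPart, letterPart]
  | cons s t ih =>
    rw [List.map_cons, List.prod_cons, ih]
    cases s with
    | inl c => rw [Sum.elim_inl, ← Algebra.smul_def, smul_smul, scalarPart_inl, letterPart_inl]
    | inr i => rw [Sum.elim_inr, mul_smul_comm, scalarPart_inr, letterPart_inr, word_cons]

namespace Expr

lemma eval_eq_sum (e : Expr F m) : e.eval (FreeAlgebra.ι F) =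
    (e.map fun t => scalarPart t • word F (letterPart t)).sum := by
  simp only [eval, prod_map_eq_smul_word]

/-- The part of degree `d` of an expression. -/
def homPart (d : ℕ) (e : Expr F m) : Expr F m := e.filter fun t => (letterPart t).length = d

/-- The difference of two expressions. -/
def diff (e e' : Expr F m) : Expr F m := e ++ e'.map (Sum.inl (-1) :: ·)

/-- The coefficient of a word in an expression. -/
def coeff (w : List (Fin m)) (e : Expr F m) : F :=
  (e.map fun t => if letterPart t = w then scalarPart t else 0).sum

/-- All coefficients of words shorter than `N` vanish. -/
def LowZero (N : ℕ) (e : Expr F m) : Prop :=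
  ∀ t ∈ e, ¬ (letterPart t).length < N ∨ coeff (letterPart t) e = 0

lemma eval_homPart (d : ℕ) (e : Expr F m) :
    (e.homPart d).eval (FreeAlgebra.ι F) = component d (e.eval (FreeAlgebra.ι F)) := by
  rw [eval_eq_sum, eval_eq_sum]
  induction e with
  | nil => simp [homPart]
  | cons t e ih =>
    rw [List.map_cons, List.sum_cons, map_add, ← ih, map_smul, component_word, homPart,
      List.filter_cons]
    simp only [decide_eq_true_eq]
    split_ifs <;> simp [homPart]

lemma eval_diff {A : Type*} [Ring A] [Algebra F A] (a : Fin m → A) (e e' : Expr F m) :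
    (e.diff e').eval a = e.eval a - e'.eval a := by
  have h : ∀ l : Expr F m, eval a (l.map (Sum.inl (-1) :: ·)) = - l.eval a := fun l => by
    induction l with
    | nil => simp [eval]
    | cons t l ih =>
      simp only [eval, List.map_cons, List.sum_cons, neg_add] at ih ⊢
      rw [ih]
      simp
  rw [sub_eq_add_neg, ← h]
  simp [diff, eval]

lemma coeff_diff (w : List (Fin m)) (e e' : Expr F m) :
    coeff w (e.diff e') = coeff w e - coeff w e' := by
  have h : ∀ l : Expr F m, coeff w (l.map (Sum.inl (-1) :: ·)) = - coeff w l := fun l => by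
    induction l with
    | nil => simp [coeff]
    | cons t l ih =>
      simp only [coeff, List.map_cons, List.sum_cons, neg_add] at ih ⊢
      rw [ih]
      congr 1
      split_ifs with h1 h2 h2 <;> simp_all
  rw [sub_eq_add_neg, ← h]
  simp [diff, coeff]

lemma lowZero_diff {N : ℕ} {e e' : Expr F m}
    (h : ∀ w : List (Fin m), w.length < N → coeff w e = coeff w e') : LowZero N (e.diff e') := by
  intro t _
  rw [coeff_diff, sub_eq_zero]
  exact (em _).symm.imp_right (h _)

lemma eval_eq_linearCombination (e : Expr F m) : e.eval (FreeAlgebra.ι F) =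
    Finsupp.linearCombination F (word F)
      (e.map fun t => Finsupp.single (letterPart t) (scalarPart t)).sum := by
  rw [eval_eq_sum, map_list_sum, List.map_map]
  congr 2
  ext t
  simp

/-- `LowZero` inspects only words occurring in `e`, which keeps it a bounded, primitive recursive
test. This suffices, as all other words have coefficient zero. -/
lemma component_eval_eq_zero {N d : ℕ} {e : Expr F m} (he : LowZero N e) (hd : d < N) :
    component d (e.eval (FreeAlgebra.ι F)) = 0 := by
  rw [← eval_homPart, eval_eq_linearCombination]
  have hsum : ∀ (l : Expr F m) (w : List (Fin m)),
      (l.map fun t => Finsupp.single (letterPart t) (scalarPart t)).sum w = coeff w l := by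
    intro l w
    induction l with
    | nil => simp [coeff]
    | cons t l ih => simp [coeff, ih, Finsupp.single_apply]
  have h0 : ((e.homPart d).map fun t => Finsupp.single (letterPart t) (scalarPart t)).sum = 0 := by
    ext w
    rw [hsum, Finsupp.zero_apply]
    by_cases hw : w.length = d
    · have h1 : ∀ l : Expr F m, coeff w (l.homPart d) = coeff w l := by
        intro l
        induction l with
        | nil => rfl
        | cons t l ih =>
          rw [homPart, List.filter_cons]
          simp only [decide_eq_true_eq]
          split_ifs with h
          · simpa [coeff, homPart] using ih
          · have : letterPart t ≠ w := by rintro rfl; exact h hw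
            simpa [coeff, homPart, this] using ih
      rw [h1]
      by_cases ht : ∃ t ∈ e, letterPart t = w
      · obtain ⟨t, ht, rfl⟩ := ht
        exact (he t ht).resolve_left (by omega)
      · push Not at ht
        refine List.sum_eq_zero fun c hc => ?_
        obtain ⟨t, hte, rfl⟩ := List.mem_map.1 hc
        exact if_neg (ht t hte)
    · refine List.sum_eq_zero fun c hc => ?_
      obtain ⟨t, hte, rfl⟩ := List.mem_map.1 hc
      rw [homPart, List.mem_filter, decide_eq_true_eq] at hte
      refine if_neg ?_
      rintro rfl
      exact hw hte.2
  rw [h0, map_zero]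

end Expr

section Primrec

variable [Primcodable F]

lemma primrec_getRight? {α β : Type*} [Primcodable α] [Primcodable β] :
    Primrec (Sum.getRight? : α ⊕ β → Option β) :=
  (Primrec.sumCasesOn Primrec.id (Primrec.const none).to₂
    (Primrec.option_some.comp Primrec.snd).to₂).of_eq fun s => by cases s <;> rfl

lemma primrec_getLeft? {α β : Type*} [Primcodable α] [Primcodable β] :
    Primrec (Sum.getLeft? : α ⊕ β → Option α) :=
  (Primrec.sumCasesOn Primrec.id (Primrec.option_some.comp Primrec.snd).to₂
    (Primrec.const none).to₂).of_eq fun s => by cases s <;> rfl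

lemma primrec_letterPart {F : Type*} [Primcodable F] :
    Primrec (letterPart : List (F ⊕ Fin m) → List (Fin m)) :=
  Primrec.listFilterMap Primrec.id (primrec_getRight?.comp Primrec.snd).to₂

lemma primrec_list_foldr_finite {α : Type*} [Primcodable α] [Finite α] (op : α → α → α) (c : α) :
    Primrec (List.foldr op c) :=
  Primrec.list_foldr Primrec.id (Primrec.const c)
    ((Primrec.dom_finite fun p : α × α => op p.1 p.2).comp Primrec.snd).to₂

lemma primrec_scalarPart [Finite F] : Primrec (scalarPart : List (F ⊕ Fin m) → F) :=
  ((primrec_list_foldr_finite (· * ·) 1).comp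
    (Primrec.listFilterMap Primrec.id (primrec_getLeft?.comp Primrec.snd).to₂)).of_eq
    fun _ => rfl

namespace Expr

lemma primrec_coeff [Finite F] : Primrec₂ (coeff : List (Fin m) → Expr F m → F) := by
  refine ((primrec_list_foldr_finite (· + ·) 0).comp (Primrec.list_map Primrec.snd
    (g := fun (p : List (Fin m) × Expr F m) (t : List (F ⊕ Fin m)) =>
      if letterPart t = p.1 then scalarPart t else 0) ?_)).of_eq fun _ => rfl
  exact Primrec.ite (Primrec.eq.comp (primrec_letterPart.comp Primrec.snd)
    (Primrec.fst.comp Primrec.fst)) (primrec_scalarPart.comp Primrec.snd) (Primrec.const 0)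

lemma primrec_homPart {F : Type*} [Primcodable F] :
    Primrec₂ (homPart : ℕ → Expr F m → Expr F m) := by
  have h : PrimrecRel fun (t : List (F ⊕ Fin m)) (d : ℕ) => (letterPart t).length = d :=
    Primrec.eq.comp (Primrec.list_length.comp (primrec_letterPart.comp Primrec.fst)) Primrec.snd
  exact h.listFilter.swap

lemma primrec_diff : Primrec₂ (diff : Expr F m → Expr F m → Expr F m) :=
  Primrec.list_append.comp Primrec.fst (Primrec.list_map Primrec.snd
    (Primrec.list_cons.comp (Primrec.const _) Primrec.snd).to₂)

lemma primrecRel_lowZero [Finite F] : PrimrecRel (LowZero : ℕ → Expr F m → Prop) := by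
  have h : PrimrecRel fun (t : List (F ⊕ Fin m)) (p : ℕ × Expr F m) =>
      ¬ (letterPart t).length < p.1 ∨ coeff (letterPart t) p.2 = 0 := by
    refine PrimrecPred.or (PrimrecPred.not ?_) ?_
    · exact Primrec.nat_lt.comp (Primrec.list_length.comp (primrec_letterPart.comp Primrec.fst))
        (Primrec.fst.comp Primrec.snd)
    · exact Primrec.eq.comp (primrec_coeff.comp (primrec_letterPart.comp Primrec.fst)
        (Primrec.snd.comp Primrec.snd)) (Primrec.const 0)
  exact h.forall_mem_list.comp Primrec.snd Primrec.id

end Expr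

end Primrec

end Expressions

/-! ### Universal enumeration, effective search, and recursively enumerable unions. -/

section Computability

open Encodable Denumerable
open Nat.Partrec (Code)

/-- A partial recursive enumeration of all computable sequences. -/
lemma exists_universal_sequence (α : Type*) [Primcodable α] [Inhabited α] :
    ∃ U : ℕ → ℕ →. α, Partrec₂ U ∧
      ∀ w : ℕ → α, Computable w → ∃ e, ∀ j, U e j = Part.some (w j) := by
  refine ⟨fun e j => (Code.eval (ofNat Code e) j).map fun x => (decode x : Option α).getD default,
    ?_, fun w hw => ?_⟩
  · refine Partrec.map (Code.eval_part.comp ((Computable.ofNat Code).comp Computable.fst)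
      Computable.snd) ?_
    exact Computable.option_getD (Computable.decode.comp Computable.snd) (Computable.const _)
  · obtain ⟨c, hc⟩ := Code.exists_code.1 (Partrec.nat_iff.1 (Computable.encode.comp hw).partrec)
    refine ⟨encode c, fun j => ?_⟩
    beta_reduce
    rw [ofNat_encode, hc]
    simp

/-- Search for a pair of terms of a partial recursive sequence passing a test. -/
lemma exists_pair_search {α : Type*} [Primcodable α] {U : ℕ → ℕ →. α} (hU : Partrec₂ U)
    {T : ℕ → α × α → Prop} (hT : PrimrecRel T) :
    ∃ S : ℕ →. α × α, Partrec S ∧ (∀ e, ∀ p ∈ S e, T e p) ∧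
      ∀ e (w : ℕ → α), (∀ j, U e j = Part.some (w j)) → (∃ j k, j < k ∧ T e (w j, w k)) →
        ∃ j k, j < k ∧ (w j, w k) ∈ S e := by
  classical
  let pr : ℕ → ℕ →. α × α := fun e q =>
    (U e q.unpair.1).bind fun x => (U e q.unpair.2).map fun y => (x, y)
  have hpr : Partrec₂ pr := by
    refine Partrec.bind (hU.comp Computable.fst (Computable.fst.comp (Computable.unpair.comp
      Computable.snd))) (Partrec.map (hU.comp (Computable.fst.comp Computable.fst)
      (Computable.snd.comp (Computable.unpair.comp (Computable.snd.comp Computable.fst)))) ?_)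
    exact Computable.pair (Computable.snd.comp Computable.fst) Computable.snd
  let tst : ℕ → ℕ →. Bool := fun e q =>
    (pr e q).map fun p => decide (q.unpair.1 < q.unpair.2 ∧ T e p)
  have htst : Partrec₂ tst := by
    refine Partrec.map hpr ?_
    have h : PrimrecPred fun z : (ℕ × ℕ) × α × α =>
        z.1.2.unpair.1 < z.1.2.unpair.2 ∧ T z.1.1 z.2 := by
      refine PrimrecPred.and (Primrec.nat_lt.comp ?_ ?_) (hT.comp (Primrec.fst.comp Primrec.fst)
        Primrec.snd)
      · exact Primrec.fst.comp (Primrec.unpair.comp (Primrec.snd.comp Primrec.fst))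
      · exact Primrec.snd.comp (Primrec.unpair.comp (Primrec.snd.comp Primrec.fst))
    exact (primrecPred_iff_primrec_decide.1 h).to_comp
  refine ⟨fun e => (Nat.rfind (tst e)).bind (pr e), ?_, ?_, ?_⟩
  · exact Partrec.bind (Partrec.rfind htst) hpr
  · intro e p hp
    obtain ⟨q, hq, hp⟩ := Part.mem_bind_iff.1 hp
    obtain ⟨p', hp', h⟩ := (Part.mem_map_iff _).1 (Nat.rfind_spec hq)
    obtain rfl := Part.mem_unique hp hp'
    exact (of_decide_eq_true h).2
  · rintro e w hw ⟨j, k, hjk, hT⟩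
    have hpe : ∀ q, pr e q = Part.some (w q.unpair.1, w q.unpair.2) := fun q => by
      simp [pr, hw]
    have hte : ∀ q, tst e q = Part.some
        (decide (q.unpair.1 < q.unpair.2 ∧ T e (w q.unpair.1, w q.unpair.2))) := fun q => by
      simp [tst, hpe]
    -- The sequence being total, no earlier test diverges and the search reaches the code of `(j,
    -- k)`. It may stop sooner, at a different pair that also passes.
    have hdom : (Nat.rfind (tst e)).Dom := by
      rw [Nat.rfind_dom]
      refine ⟨Nat.pair j k, ?_, fun _ => by simp [hte]⟩
      simp [hte, hjk, hT]
    obtain ⟨q, hq⟩ := Part.dom_iff_mem.1 hdom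
    have hs := Nat.rfind_spec hq
    rw [hte, Part.mem_some_iff] at hs
    have hlt := (of_decide_eq_true hs.symm).1
    exact ⟨_, _, hlt, Part.mem_bind_iff.2 ⟨q, hq, by rw [hpe]; exact Part.mem_some _⟩⟩

/-- The union of a partial recursive sequence of finite lists is recursively enumerable. -/
lemma rePred_exists_mem_list {β : Type*} [Primcodable β] {T : ℕ →. List β} (hT : Partrec T) :
    REPred fun b => ∃ q, ∃ l ∈ T q, b ∈ l := by
  classical
  obtain ⟨c, hc⟩ := Code.exists_code.1
    (Partrec.nat_iff.1 (hT.map (Computable.encode.comp Computable.snd).to₂))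
  -- Dovetailing: `k` codes both a step bound and an index `q`, so a divergent `T q` blocks nothing.
  let g : β → ℕ → Option Unit := fun b k =>
    (Code.evaln k.unpair.1 c k.unpair.2).bind fun x =>
      (decode x : Option (List β)).bind fun l => if ∃ a ∈ l, a = b then some () else none
  have hg : Primrec₂ g := by
    refine Primrec.option_bind (Code.primrec_evaln.comp ((Primrec.pair (Primrec.fst.comp
      (Primrec.unpair.comp Primrec.snd)) (Primrec.const c)).pair (Primrec.snd.comp
      (Primrec.unpair.comp Primrec.snd)))) (Primrec.option_bind (Primrec.decode.comp Primrec.snd)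
      (Primrec.ite ?_ (Primrec.const _) (Primrec.const _)))
    exact (PrimrecRel.exists_mem_list Primrec.eq).comp Primrec.snd
      (Primrec.fst.comp (Primrec.fst.comp Primrec.fst))
  refine (Partrec.dom_re (Partrec.rfindOpt hg.to_comp)).of_eq fun b => ?_
  rw [Nat.rfindOpt_dom]
  constructor
  · rintro ⟨k, ⟨⟩, h⟩
    obtain ⟨x, hx, h⟩ := Option.bind_eq_some_iff.1 h
    obtain ⟨l, hl, h⟩ := Option.bind_eq_some_iff.1 h
    have hx' := Code.evaln_sound hx
    rw [hc] at hx'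
    obtain ⟨l', hl', rfl⟩ := (Part.mem_map_iff _).1 hx'
    rw [encodek, Option.some_inj] at hl
    subst hl
    refine ⟨_, l', hl', ?_⟩
    by_contra hb
    simp [hb] at h
  · rintro ⟨q, l, hl, hb⟩
    have hx : encode l ∈ Code.eval c q := by rw [hc]; exact Part.mem_map _ hl
    obtain ⟨k, hk⟩ := Code.evaln_complete.1 hx
    refine ⟨Nat.pair k q, (), ?_⟩
    simp only [g, Nat.unpair_pair]
    rw [Option.mem_def.1 hk]
    simp [hb]

end Computability

/-! ### The relations, their weight and their enumeration. -/

section Construction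

variable {F : Type*} [Field F] {m : ℕ}

/-- The differences of corresponding entries of two lists of expressions. -/
def diffs (p : List (Expr F m) × List (Expr F m)) (s : ℕ) : Expr F m :=
  (p.1.getD s []).diff (p.2.getD s [])

/-- Below this degree the relations supplied by the program with index `e` vanish. -/
def threshold (e : ℕ) (p : List (Expr F m) × List (Expr F m)) : ℕ := e + 2 + p.1.length

/-- The two tuples have the same length and agree in low degrees. -/
def AgreeLow (e : ℕ) (p : List (Expr F m) × List (Expr F m)) : Prop :=
  p.1.length = p.2.length ∧ ∀ s < p.1.length, (diffs p s).LowZero (threshold e p)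

lemma tsum_weight_le (len : ℕ → ℕ) :
    ∑' i : Σ e, Fin (len e) × ℕ, (2 : ENNReal)⁻¹ ^ (i.1 + 2 + len i.1 + i.2.2) ≤ 1 := by
  have hgeo : ∑' k : ℕ, (2 : ENNReal)⁻¹ ^ k = 2 := by
    rw [ENNReal.tsum_geometric, ENNReal.one_sub_inv_two, inv_inv]
  have h2 : (2 : ENNReal)⁻¹ * 2 = 1 := ENNReal.inv_mul_cancel (by simp) (by simp)
  have hn : ∀ n : ℕ, (n : ENNReal) * 2⁻¹ ^ n ≤ 1 := fun n => by
    calc (n : ENNReal) * 2⁻¹ ^ n ≤ 2 ^ n * 2⁻¹ ^ n := by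
          gcongr; exact_mod_cast Nat.lt_two_pow_self.le
      _ = 1 := by rw [← mul_pow, mul_comm, h2, one_pow]
  rw [ENNReal.tsum_sigma']
  calc _ ≤ ∑' e : ℕ, (2 : ENNReal)⁻¹ * 2⁻¹ ^ e := by
        refine ENNReal.tsum_le_tsum fun e => ?_
        rw [ENNReal.tsum_prod']
        simp only [pow_add, ENNReal.tsum_mul_left, hgeo]
        rw [tsum_fintype, Finset.sum_const, Finset.card_univ, Fintype.card_fin, nsmul_eq_mul]
        calc _ = (2 : ENNReal)⁻¹ * 2⁻¹ ^ e * (2⁻¹ * 2) * (len e * 2⁻¹ ^ len e) := by ring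
          _ ≤ (2 : ENNReal)⁻¹ * 2⁻¹ ^ e * 1 * 1 := by rw [h2]; gcongr; exact hn _
          _ = _ := by ring
    _ = 1 := by rw [ENNReal.tsum_mul_left, hgeo, h2]

/-- Pigeonhole: finitely many short words with coefficients in a finite field leave finitely many
low-degree patterns. This is what makes the search for total programs succeed. -/
lemma exists_coeff_eq [Finite F] {n : ℕ} (u : ℕ → Fin n → Expr F m) (N : ℕ) :
    ∃ j k, j < k ∧ ∀ s, ∀ w : List (Fin m), w.length < N →
      Expr.coeff w (u j s) = Expr.coeff w (u k s) := by
  have : Finite {w : List (Fin m) // w.length < N} := (List.finite_length_lt (Fin m) N).to_subtype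
  obtain ⟨j, k, hjk, h⟩ := Finite.exists_ne_map_eq_of_infinite fun j =>
    fun (s : Fin n) (w : {w : List (Fin m) // w.length < N}) => Expr.coeff w.1 (u j s)
  have h' : ∀ s, ∀ w : List (Fin m), w.length < N →
      Expr.coeff w (u j s) = Expr.coeff w (u k s) := fun s w hw =>
    congr_fun (congr_fun h s) ⟨w, hw⟩
  rcases hjk.lt_or_gt with hlt | hlt
  · exact ⟨j, k, hlt, h'⟩
  · exact ⟨k, j, hlt, fun s w hw => (h' s w hw).symm⟩

variable [Primcodable F]

lemma primrec_diffs : Primrec₂ (diffs (F := F) (m := m)) :=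
  Expr.primrec_diff.comp
    ((Primrec.list_getD []).comp (Primrec.fst.comp Primrec.fst) Primrec.snd)
    ((Primrec.list_getD []).comp (Primrec.snd.comp Primrec.fst) Primrec.snd)

lemma primrec_threshold {F : Type*} [Primcodable F] :
    Primrec₂ (threshold (F := F) (m := m)) :=
  Primrec.nat_add.comp (Primrec.nat_add.comp Primrec.fst (Primrec.const 2))
    (Primrec.list_length.comp (Primrec.fst.comp Primrec.snd))

lemma primrecRel_agreeLow [Finite F] : PrimrecRel (AgreeLow (F := F) (m := m)) := by
  refine PrimrecPred.and (Primrec.eq.comp (Primrec.list_length.comp (Primrec.fst.comp Primrec.snd))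
    (Primrec.list_length.comp (Primrec.snd.comp Primrec.snd))) ?_
  have h : PrimrecRel fun (s : ℕ) (z : ℕ × List (Expr F m) × List (Expr F m)) =>
      (diffs z.2 s).LowZero (threshold z.1 z.2) :=
    Expr.primrecRel_lowZero.comp (primrec_threshold.comp (Primrec.fst.comp Primrec.snd)
      (Primrec.snd.comp Primrec.snd))
      (primrec_diffs.comp (Primrec.snd.comp Primrec.snd) Primrec.fst)
  exact (h.forall_mem_list.comp (Primrec.list_range.comp (Primrec.list_length.comp
    (Primrec.fst.comp Primrec.snd))) Primrec.id).of_eq fun z => by simp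

/-- Few homogeneous relations that identify two terms of every computable sequence of tuples. -/
theorem exists_relations (F : Type*) [Field F] [Finite F] [Primcodable F] (m : ℕ) :
    ∃ (len : ℕ → ℕ) (f : (Σ e, Fin (len e) × ℕ) → FreeAlgebra F (Fin m)),
      (∀ i, f i ∈ homogeneous F m (i.1 + 2 + len i.1 + i.2.2)) ∧
      (∃ p : Expr F m → Prop, REPred p ∧ Set.range f = Expr.eval (FreeAlgebra.ι F) '' {e | p e}) ∧
      ∀ (n : ℕ) (u : ℕ → Fin n → Expr F m), Computable u → ∃ j k, j < k ∧
        ∀ s, (u j s).eval (FreeAlgebra.ι F) - (u k s).eval (FreeAlgebra.ι F) ∈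
          TwoSidedIdeal.span (Set.range f) := by
  classical
  -- Coding tuples as lists lets one enumeration serve every `n`; the length of the pair found
  -- supplies `n`.
  obtain ⟨U, hU, hUw⟩ := exists_universal_sequence (List (Expr F m))
  obtain ⟨S, hS, hST, hSw⟩ := exists_pair_search hU (primrecRel_agreeLow (F := F) (m := m))
  -- When the search diverges, the default empty lists contribute no relations. `P` itself need not
  -- be computable: the enumeration `T` below uses only the partial function `S`.
  let P : ℕ → List (Expr F m) × List (Expr F m) := fun e =>
    if h : (S e).Dom then (S e).get h else ([], [])
  have hP : ∀ e, ∀ p ∈ S e, P e = p := fun e p ⟨hd, hp⟩ => by simp only [P, dif_pos hd, hp]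
  let f : (Σ e, Fin (P e).1.length × ℕ) → FreeAlgebra F (Fin m) := fun i =>
    ((diffs (P i.1) i.2.1).homPart (threshold i.1 (P i.1) + i.2.2)).eval (FreeAlgebra.ι F)
  refine ⟨fun e => (P e).1.length, f, fun i => ?_, ?_, fun n u hu => ?_⟩
  · simp only [f, Expr.eval_homPart]
    exact component_mem _ _
  · let T : ℕ →. List (Expr F m) := fun q => (S q.unpair.1).map fun p =>
      (List.range p.1.length).map fun s =>
        (diffs p s).homPart (threshold q.unpair.1 p + q.unpair.2)
    have hT : Partrec T := by
      refine Partrec.map (hS.comp (Computable.fst.comp Computable.unpair)) (Primrec.to_comp ?_)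
      refine Primrec.list_map (Primrec.list_range.comp (Primrec.list_length.comp
        (Primrec.fst.comp Primrec.snd))) (Expr.primrec_homPart.comp (Primrec.nat_add.comp
          (primrec_threshold.comp ?_ ?_) ?_) (primrec_diffs.comp ?_ Primrec.snd))
      · exact Primrec.fst.comp (Primrec.unpair.comp (Primrec.fst.comp Primrec.fst))
      · exact Primrec.snd.comp Primrec.fst
      · exact Primrec.snd.comp (Primrec.unpair.comp (Primrec.fst.comp Primrec.fst))
      · exact Primrec.snd.comp Primrec.fst
    refine ⟨_, rePred_exists_mem_list hT, ?_⟩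
    ext x
    constructor
    · rintro ⟨⟨e, s, d⟩, rfl⟩
      have hd : (S e).Dom := by
        by_contra h
        have hs := s.2
        simp [P, h] at hs
      refine ⟨_, ⟨Nat.pair e d, _, Part.mem_map _ (?_ : P e ∈ S (Nat.pair e d).unpair.1), ?_⟩, rfl⟩
      · simp only [Nat.unpair_pair, P, dif_pos hd]
        exact Part.get_mem hd
      · simp only [Nat.unpair_pair]
        exact List.mem_map.2 ⟨s, List.mem_range.2 s.2, rfl⟩
    · rintro ⟨g, ⟨q, l, hl, hg⟩, rfl⟩
      obtain ⟨p, hp, rfl⟩ := (Part.mem_map_iff _).1 hl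
      obtain ⟨s, hs, rfl⟩ := List.mem_map.1 hg
      obtain rfl := hP _ _ hp
      exact ⟨⟨q.unpair.1, ⟨s, List.mem_range.1 hs⟩, q.unpair.2⟩, rfl⟩
  · have hw : Computable fun j => List.ofFn (u j) :=
      Computable.list_ofFn fun s => Computable.fin_app.comp hu (Computable.const s)
    obtain ⟨e, he⟩ := hUw _ hw
    have hdiff : ∀ j k (s : Fin n), diffs (List.ofFn (u j), List.ofFn (u k)) s =
        (u j s).diff (u k s) := fun j k s => by
      simp [diffs]
    obtain ⟨j, k, hjk, hcoeff⟩ := exists_coeff_eq u (e + 2 + n)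
    obtain ⟨j', k', hjk', hmem⟩ := hSw e _ he ⟨j, k, hjk, by simp, fun s hs => by
      simp only [List.length_ofFn] at hs
      rw [show s = ((⟨s, hs⟩ : Fin n) : ℕ) from rfl, hdiff]
      refine Expr.lowZero_diff fun w hw => hcoeff _ w ?_
      simpa [threshold] using hw⟩
    have hlow := hST e _ hmem
    have hPe := hP e _ hmem
    refine ⟨j', k', hjk', fun s => ?_⟩
    rw [← Expr.eval_diff, ← hdiff]
    have hs : (s : ℕ) < (List.ofFn (u j')).length := by simp
    rw [← hPe] at hlow ⊢
    have hs' : (s : ℕ) < (P e).1.length := by rw [hPe]; exact hs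
    refine mem_of_component_mem fun d => ?_
    -- Below the threshold the component of the difference vanishes; from it on, the component is
    -- one of the relations.
    by_cases hd : d < threshold e (P e)
    · rw [Expr.component_eval_eq_zero (hlow.2 s hs') hd]
      exact zero_mem _
    · refine TwoSidedIdeal.subset_span ⟨⟨e, ⟨s, hs'⟩, d - threshold e (P e)⟩, ?_⟩
      simp only [f, Expr.eval_homPart, Nat.add_sub_cancel' (not_lt.1 hd)]

/-- The sequence of powers of a generator, as 1-tuples; a repetition in it forces nilpotency. -/
lemma computable_power_expr {F : Type*} [Primcodable F] (i : Fin m) :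
    Computable fun (j : ℕ) (_ : Fin 1) => ([List.replicate j (Sum.inr i)] : Expr F m) := by
  have h : Primrec fun j : ℕ => List.replicate j (Sum.inr i : F ⊕ Fin m) :=
    (Primrec.list_map Primrec.list_range (Primrec.const (Sum.inr i)).to₂).of_eq fun j => by simp
  refine Primrec.to_comp (Primrec.fin_curry.2 ?_)
  exact Primrec.list_cons.comp (h.comp Primrec.fst) (Primrec.const [])

end Construction

end AlgFin

theorem mainTheorem2 (F : Type*) [Field F] [Finite F] (m : ℕ) (hm : 4 ≤ m) :
    ∃ R : Set (FreeAlgebra F (Fin m)),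
      AlgFin.IsRecursivelyEnumerable R ∧
      (∀ r ∈ R, ∃ d : ℕ, r ∈ AlgFin.homogeneous F m d) ∧
      Infinite (AlgFin.Presented R) ∧
      AlgFin.IsResiduallyFinite (AlgFin.Presented R) ∧
      Algebra.adjoin F (Set.range (AlgFin.Presented.gen R)) = ⊤ ∧
      (∀ i : Fin m, IsNilpotent (AlgFin.Presented.gen R i)) ∧
      (∀ n : ℕ, 0 < n →
        AlgFin.IsAlgorithmicallyFinitePower F (AlgFin.Presented.gen R) n) := by
  let := AlgFin.finitePrimcodable F
  obtain ⟨len, f, hf, hre, hcomp⟩ := AlgFin.exists_relations F m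
  refine ⟨Set.range f, hre, ?_, ?_, AlgFin.isResiduallyFinite_presented hf,
    AlgFin.adjoin_gen_presented _, fun i => ?_, fun n _ => ?_⟩
  · rintro _ ⟨i, rfl⟩; exact ⟨_, hf i⟩
  · exact AlgFin.infinite_presented hm hf (fun i => by omega) (AlgFin.tsum_weight_le len)
  · obtain ⟨j, k, hjk, h⟩ := hcomp 1 _ (AlgFin.computable_power_expr i)
    have hpow : ∀ l : ℕ, AlgFin.Expr.eval (FreeAlgebra.ι F)
        ([List.replicate l (Sum.inr i)] : AlgFin.Expr F m) =
          AlgFin.word F (List.replicate l i) := fun l => by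
      simp [AlgFin.Expr.eval, AlgFin.word]
    -- As `j < k`, the component of degree `j` of `xᵢʲ - xᵢᵏ` is `xᵢʲ` alone.
    have h' := AlgFin.component_mem_span hf (h 0) j
    rw [hpow, hpow, map_sub, AlgFin.component_word, AlgFin.component_word, List.length_replicate,
      List.length_replicate, if_pos rfl, if_neg hjk.ne'] at h'
    have hw : AlgFin.word F (List.replicate j i) = FreeAlgebra.ι F i ^ j := by simp [AlgFin.word]
    rw [hw, ← AlgFin.Presented.mk_eq_mk_iff, map_pow, map_zero] at h'
    exact ⟨j, h'⟩
  · rintro ⟨u, hu, hinj⟩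
    obtain ⟨j, k, hjk, h⟩ := hcomp n u hu
    refine hjk.ne (hinj ?_)
    funext s
    simp only [AlgFin.eval_gen]
    exact AlgFin.Presented.mk_eq_mk_iff.2 (h s)
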